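/- Let $G$ be a finite simple bridgeless cubic graph (not necessarily connected). For $W\subseteq V(G)$, the boundary $\partial(W)$ is the set of edges with precisely one end-vertex in $W$, and $\partial(H)=\partial(V(H))$ for a subgraph $H$ of $G$. A $3$-edge-cut is a set of exactly three edges of the form $\partial(W)$. A $2$-factor is a spanning subgraph in which every vertex has degree $2$. A good collection is a collection $\mathcal{H}$ of induced subgraphs of $G$ all of which have the same number of vertices and the same number $b_{\mathcal{H}}\in\{2,4,5,6,7,9\}$ of boundary edges. Put $a_{\mathcal{H}}=2\lfloor b_{\mathcal{H}}/2\rfloor$; for a $2$-factor $F$ let $\mathcal{H}^{k}(F)$ be the set of those $H\in\mathcal{H}$ with exactly $k$ edges of $\partial(H)$ in $F$, and let $\mathcal{H}^{*}(F)=\mathcal{H}^{a_{\mathcal{H}}}(F)$. Let $\mathcal{I}$ be a finite set of good collections of induced subgraphs of $G$, and for each $\mathcal{H}\in\mathcal{I}$ let $A_{\mathcal{H}}$ be a real number, with $A_{\mathcal{H}}\ge 0$ whenever $b_{\mathcal{H}}\neq 2$. Then there exists a $2$-factor $F$ of $G$ that contains exactly two edges of each $3$-edge-cut of $G$ and such that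 $$\sum_{\mathcal{H}\in\mathcal{I}} A_{\mathcal{H}}\cdot\left[\,2\, b_{\mathcal{H}}\,|\mathcal{H}^{0}(F)|-(3a_{\mathcal{H}}-2b_{\mathcal{H}})\,|\mathcal{H}^{*}(F)|\,\right]\le 0 .$$ -/

import Mathlib

namespace CubicFactor

variable {V : Type*}

/-- A graph is bridgeless if none of its edges is a bridge. -/
def Bridgeless (G : SimpleGraph V) : Prop :=
  ∀ e ∈ G.edgeSet, ¬ G.IsBridge e

/-- The boundary of a vertex set `W`: the edges with precisely one end-vertex in `W`. -/
def boundary (G : SimpleGraph V) (W : Set V) : Set (Sym2 V) :=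
  {e ∈ G.edgeSet | ∃ u ∈ W, ∃ v ∉ W, e = s(u, v)}

/-- A `k`-edge-cut: a set of exactly `k` edges that is the boundary of some vertex set. -/
def IsEdgeCut (G : SimpleGraph V) (k : ℕ) (S : Set (Sym2 V)) : Prop :=
  S.ncard = k ∧ ∃ W : Set V, S = boundary G W

/-- A `2`-factor: a spanning subgraph in which every vertex has degree `2`. -/
def IsTwoFactor {G : SimpleGraph V} (F : G.Subgraph) : Prop :=
  F.IsSpanning ∧ ∀ v : V, (F.neighborSet v).ncard = 2

/-- A good collection of induced subgraphs of `G`: all members have the same number `n` of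
vertices and the same number `b` of boundary edges, where `b` is one of `2, 4, 5, 6, 7, 9`.
(The numbers are recorded as data so that they make sense for the empty collection too.) -/
structure GoodCollection (G : SimpleGraph V) where
  members : Set G.Subgraph
  n : ℕ
  b : ℕ
  isInduced : ∀ H ∈ members, H.IsInduced
  card_verts : ∀ H ∈ members, H.verts.ncard = n
  card_boundary : ∀ H ∈ members, (boundary G H.verts).ncard = b
  b_mem : b ∈ ({2, 4, 5, 6, 7, 9} : Set ℕ)

namespace GoodCollection

variable {G : SimpleGraph V}

/-- `a = 2 ⌊b / 2⌋`, the largest even number not exceeding `b`. -/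
def a (C : GoodCollection G) : ℕ := 2 * (C.b / 2)

/-- The members of the collection with exactly `k` boundary edges in `F`. -/
def level (C : GoodCollection G) (F : G.Subgraph) (k : ℕ) : Set G.Subgraph :=
  {H ∈ C.members | (boundary G H.verts ∩ F.edgeSet).ncard = k}

/-- The members of the collection with exactly `a` boundary edges in `F`. -/
def star (C : GoodCollection G) (F : G.Subgraph) : Set G.Subgraph := C.level F C.a

end GoodCollection

end CubicFactor

/-!
In a bridgeless cubic graph `G`, the weight `1 / 3` on every edge lies in Edmonds' perfect matching
polytope: an odd vertex set has an odd number of boundary edges, and one boundary edge would be a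
bridge. Hence there is a probability distribution on perfect matchings which contains each edge with
probability `1 / 3`, and the complementary `2`-factors contain each edge with probability `2 / 3`.
A `3`-edge-cut bounds an odd vertex set, so every perfect matching meets it; as the mean number of
common edges is one, every matching of positive probability meets it exactly once.

Let `X = |∂(H) ∩ F|` for a member `H` of a good collection with `b` boundary edges and
`a = 2 ⌊b / 2⌋`. Then `X` is even and at most `b`, and for the six admissible values of `b` the
contribution `2 b [X = 0] - (3 a - 2 b) [X = a]` is at most `2 b - 3 X`, because `a - 2 ≤ 2 b / 3`
(`contribution_le`); for `b = 2` it is an equality, which is why the sign of the coefficient does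
not matter there. The bound is linear in `F` and has mean zero, so some `F` of positive probability
makes the weighted sum nonpositive.

Edmonds' theorem (`IsFeasible.isMixture`) is proved by induction on the number of vertices and the
size of the support. If a feasible weighting `x` has an odd cut of weight one which is not the
boundary of a vertex, both sides are shrunk to a point and the resulting distributions are coupled
along the crossing edge (`IsPointedMixture.isMixture`). Otherwise Tutte's theorem gives a perfect
matching in the support of `x` (`IsFeasible.exists_isMatchingMatrix`), and moving away from it
shrinks the support or produces such a cut (`IsFeasible.exists_peel`).
-/

open Finset

universe u

namespace CubicFactor

/-! ### Cuts and feasible weightings -/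

section Cuts

variable {V : Type u} [DecidableEq V]

lemma even_sum_sum_of_symm (f : V → V → ℕ) (hs : ∀ u v, f u v = f v u) (hd : ∀ u, f u u = 0)
    (S : Finset V) : Even (∑ u ∈ S, ∑ v ∈ S, f u v) := by
  induction S using Finset.induction_on with
  | empty => simp
  | insert a S ha ih =>
    have h : ∑ u ∈ insert a S, ∑ v ∈ insert a S, f u v
        = 2 * ∑ v ∈ S, f a v + ∑ u ∈ S, ∑ v ∈ S, f u v := by
      simp only [sum_insert ha, sum_add_distrib, hd]
      rw [sum_congr rfl fun u _ => hs u a]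
      ring
    rw [h]
    exact (even_two_mul _).add ih

variable [Fintype V]

/-- The total weight `∑ x u v` over pairs with `u` in `S` and `v` outside `S`. A weighting of the
edges of a graph is encoded as a symmetric function of two vertices. -/
def cut {R : Type*} [AddCommMonoid R] (x : V → V → R) (S : Finset V) : R :=
  ∑ u ∈ S, ∑ v ∈ Sᶜ, x u v

lemma sum_add_cut {R : Type*} [AddCommMonoid R] (f : V → V → R) (d : R)
    (hr : ∀ u, ∑ v, f u v = d) (S : Finset V) :
    ∑ u ∈ S, ∑ v ∈ S, f u v + cut f S = #S • d := by
  rw [cut, ← sum_add_distrib, ← sum_const]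
  exact sum_congr rfl fun u _ => by rw [sum_add_sum_compl, hr]

/-- The handshake lemma for a vertex set of a regular multigraph. -/
lemma even_cut_iff (f : V → V → ℕ) (hs : ∀ u v, f u v = f v u) (hd : ∀ u, f u u = 0) (d : ℕ)
    (hr : ∀ u, ∑ v, f u v = d) (S : Finset V) : Even (cut f S) ↔ Even (#S * d) := by
  have h := sum_add_cut f d hr S
  rw [smul_eq_mul] at h
  rw [← h, Nat.even_add]
  simp [even_sum_sum_of_symm f hs hd S]

lemma cut_compl {R : Type*} [AddCommMonoid R] (x : V → V → R) (hs : ∀ u v, x u v = x v u)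
    (S : Finset V) : cut x Sᶜ = cut x S := by
  rw [cut, cut, compl_compl, sum_comm]
  exact sum_congr rfl fun u _ => sum_congr rfl fun v _ => hs _ _

/-- A symmetric weighting satisfying the inequalities of Edmonds' perfect matching polytope:
weight one at every vertex, and weight at least one across every odd vertex set. -/
structure IsFeasible (x : V → V → ℝ) : Prop where
  symm : ∀ u v, x u v = x v u
  nonneg : ∀ u v, 0 ≤ x u v
  diag : ∀ u, x u u = 0
  row : ∀ u, ∑ v, x u v = 1
  odd_cut : ∀ S : Finset V, Odd #S → 1 ≤ cut x S

/-- The adjacency matrix of a perfect matching. -/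
structure IsMatchingMatrix (M : V → V → ℕ) : Prop where
  symm : ∀ u v, M u v = M v u
  diag : ∀ u, M u u = 0
  row : ∀ u, ∑ v, M u v = 1

/-- `x` is a convex combination of adjacency matrices of perfect matchings. -/
def IsMixture (x : V → V → ℝ) : Prop :=
  ∃ (ι : Type u) (_ : Fintype ι) (c : ι → ℝ) (M : ι → V → V → ℕ), (∀ i, 0 ≤ c i) ∧
    ∑ i, c i = 1 ∧ (∀ i, IsMatchingMatrix (M i)) ∧ ∀ u v, ∑ i, c i * M i u v = x u v

lemma IsMatchingMatrix.one_le_cut {M : V → V → ℕ} (hM : IsMatchingMatrix M) {S : Finset V}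
    (hS : Odd #S) : 1 ≤ cut M S := by
  have h := even_cut_iff M hM.symm hM.diag 1 hM.row S
  rw [mul_one, ← Nat.not_odd_iff_even, ← Nat.not_odd_iff_even, not_iff_not] at h
  exact (h.2 hS).pos

lemma IsFeasible.even_card {x : V → V → ℝ} (hx : IsFeasible x) : Even (Fintype.card V) := by
  by_contra h
  have := hx.odd_cut univ (by simpa using h)
  simp [cut] at this
  linarith

lemma IsFeasible.odd_compl {x : V → V → ℝ} (hx : IsFeasible x) {S : Finset V} (hS : Odd #S) :
    Odd #Sᶜ := by
  have h := card_add_card_compl S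
  have := hx.even_card
  rw [← h] at this
  exact (Nat.even_add'.1 this).1 hS

/-- Merging vertices along a map all of whose fibres are odd sets of boundary weight one
preserves feasibility; weight inside the fibres is dropped. -/
lemma IsFeasible.pushforward {x : V → V → ℝ} (hx : IsFeasible x) {W : Type*} [Fintype W]
    [DecidableEq W] (π : V → W) (hodd : ∀ a, Odd #{u | π u = a})
    (htight : ∀ a, cut x {u | π u = a} = 1) :
    IsFeasible fun a b => if a = b then 0 else ∑ u with π u = a, ∑ v with π v = b, x u v where
  symm a b := by
    simp only [eq_comm (a := a)]
    split_ifs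
    · rfl
    · rw [sum_comm]
      exact sum_congr rfl fun u _ => sum_congr rfl fun v _ => hx.symm _ _
  nonneg a b := by
    split_ifs
    · rfl
    · exact sum_nonneg fun u _ => sum_nonneg fun v _ => hx.nonneg u v
  diag a := by simp
  row a := by
    rw [← htight a, cut, sum_comm' (s := ({u | π u = a} : Finset V)) (t := fun _ => _)
      (t' := ({u | π u = a} : Finset V)ᶜ) (s' := fun _ => ({u | π u = a} : Finset V))
      (by simp), ← sum_fiberwise _ π]
    refine sum_congr rfl fun b _ => ?_
    split_ifs with h
    · subst h
      symm
      apply sum_eq_zero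
      simp_all
    · rw [sum_comm]
      refine sum_congr ?_ fun _ _ => rfl
      ext v
      simp only [mem_filter, mem_univ, true_and, mem_compl]
      constructor
      · rintro rfl
        exact ⟨fun h' => h h'.symm, rfl⟩
      · exact fun h' => h'.2
  odd_cut T hT := by
    have key : cut (fun a b => if a = b then 0 else ∑ u with π u = a, ∑ v with π v = b, x u v) T
        = cut x {u | π u ∈ T} := by
      rw [cut, cut]
      have hc : ({u | π u ∈ T} : Finset V)ᶜ = ({u | π u ∈ Tᶜ} : Finset V) := by ext; simp
      rw [hc, ← sum_fiberwise_of_maps_to (s := ({u | π u ∈ T} : Finset V)) (t := T) (g := π)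
        (by simp)]
      refine sum_congr rfl fun a ha => ?_
      have h1 : ({u ∈ ({u | π u ∈ T} : Finset V) | π u = a} : Finset V)
          = ({u | π u = a} : Finset V) := by
        ext; simp; rintro rfl; exact ha
      rw [h1, sum_comm (t := ({u | π u ∈ Tᶜ} : Finset V)),
        ← sum_fiberwise_of_maps_to (s := ({u | π u ∈ Tᶜ} : Finset V)) (t := Tᶜ) (g := π)
        (by simp)]
      refine sum_congr rfl fun b hb => ?_
      have h2 : ({u ∈ ({u | π u ∈ Tᶜ} : Finset V) | π u = b} : Finset V)
          = ({u | π u = b} : Finset V) := by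
        ext; simp only [mem_filter, mem_univ, true_and, and_iff_right_iff_imp]; rintro rfl; exact hb
      rw [h2, if_neg (by rintro rfl; simp_all), sum_comm]
    rw [key]
    apply hx.odd_cut
    rw [card_eq_sum_card_fiberwise (f := π) (t := T) (by intro; simp)]
    rw [Finset.odd_sum_iff_odd_card_odd]
    convert hT using 2
    ext a
    simp only [mem_filter, and_iff_left_iff_imp]
    intro ha
    convert hodd a using 2
    ext; simp; rintro rfl; exact ha

end Cuts

/-! ### Gluing along a tight cut -/

section Gluing

variable {V : Type u}

/-- The trace on `S` of a perfect matching of the graph in which the complement of `S` is shrunk to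
a point: `N` is the part inside `S`, and `p` marks the vertex of `S` matched to that point. -/
structure IsPointedMatching (S : Finset V) (N : V → V → ℕ) (p : V → ℕ) : Prop where
  symm : ∀ u v, N u v = N v u
  diag : ∀ u, N u u = 0
  row : ∀ u ∈ S, ∑ v ∈ S, N u v + p u = 1
  sum_point : ∑ u ∈ S, p u = 1

/-- Averaging the coupling weights over one side leaves the weights of the other side unchanged. -/
lemma sum_coupling {S T : Finset V} {κ : Type*} [Fintype κ] {c : ℝ} {d : κ → ℝ} {p : V → ℕ}
    {q : κ → V → ℕ} {a b : V → ℝ} {x y : V → V → ℝ} (hp : ∑ u ∈ S, p u = 1)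
    (hca : ∀ u ∈ S, c * p u ≠ 0 → a u ≠ 0)
    (hy : ∀ u ∈ S, ∀ w ∈ T, y u w * a u * b w = x u w)
    (ha : ∀ u ∈ S, ∑ w ∈ T, x u w = a u) (hb : ∀ w ∈ T, ∑ j, d j * q j w = b w) :
    ∑ j, c * d j * ∑ u ∈ S, ∑ w ∈ T, p u * q j w * y u w = c := by
  calc ∑ j, c * d j * ∑ u ∈ S, ∑ w ∈ T, p u * q j w * y u w
      = ∑ j, ∑ u ∈ S, ∑ w ∈ T, c * p u * (y u w * (d j * q j w)) := by
        simp only [mul_sum]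
        exact sum_congr rfl fun j _ => sum_congr rfl fun u _ => sum_congr rfl fun w _ => by ring
    _ = ∑ u ∈ S, ∑ w ∈ T, c * p u * (y u w * b w) := by
        rw [sum_comm]
        refine sum_congr rfl fun u _ => ?_
        rw [sum_comm]
        refine sum_congr rfl fun w hw => ?_
        rw [← hb w hw, mul_sum, mul_sum]
    _ = ∑ u ∈ S, c * p u := by
        refine sum_congr rfl fun u hu => ?_
        by_cases h0 : c * (p u : ℝ) = 0
        · simp [h0]
        · have h1 : (∑ w ∈ T, y u w * b w) * a u = 1 * a u := by
            rw [one_mul, sum_mul]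
            conv_rhs => rw [← ha u hu]
            exact sum_congr rfl fun w hw => by rw [← hy u hu w hw]; ring
          rw [← mul_sum, mul_right_cancel₀ (hca u hu h0) h1, mul_one]
    _ = c := by rw [← mul_sum, ← Nat.cast_sum, hp, Nat.cast_one, mul_one]

variable [DecidableEq V]

lemma IsPointedMatching.mul_point {S : Finset V} {N : V → V → ℕ} {p : V → ℕ}
    (h : IsPointedMatching S N p) {u v : V} (hu : u ∈ S) (hv : v ∈ S) :
    p u * p v = if v = u then p u else 0 := by
  split_ifs with huv
  · subst huv
    have := h.row v hv
    have : p v ≤ 1 := by omega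
    interval_cases p v <;> rfl
  · have h1 : ∑ w ∈ {v, u}, p w ≤ ∑ w ∈ S, p w :=
      sum_le_sum_of_subset (by simp [insert_subset_iff, hu, hv])
    rw [h.sum_point, sum_pair huv] at h1
    rcases Nat.eq_zero_or_pos (p u) with h2 | h2
    · simp [h2]
    · have : p v = 0 := by omega
      simp [this]

/-- The map that fixes `S` and sends every other vertex to the extra point `none`. -/
def shrink (S : Finset V) (v : V) : Option {v // v ∈ S} := if h : v ∈ S then some ⟨v, h⟩ else none

lemma shrink_of_mem {S : Finset V} {v : V} (h : v ∈ S) : shrink S v = some ⟨v, h⟩ := dif_pos h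

lemma shrink_of_notMem {S : Finset V} {v : V} (h : v ∉ S) : shrink S v = none := dif_neg h

variable [Fintype V]

/-- The inside of `S` and the boundary weights of its vertices are a convex combination of pointed
matchings of `S`. -/
def IsPointedMixture (S : Finset V) (x : V → V → ℝ) : Prop :=
  ∃ (ι : Type u) (_ : Fintype ι) (c : ι → ℝ) (N : ι → V → V → ℕ) (p : ι → V → ℕ),
    (∀ i, 0 ≤ c i) ∧ ∑ i, c i = 1 ∧ (∀ i, IsPointedMatching S (N i) (p i)) ∧
    (∀ u ∈ S, ∀ v ∈ S, ∑ i, c i * N i u v = x u v) ∧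
    ∀ u ∈ S, ∑ i, c i * p i u = ∑ v ∈ Sᶜ, x u v

lemma filter_shrink_eq_none (S : Finset V) : ({v | shrink S v = none} : Finset V) = Sᶜ := by
  ext v; simp [shrink]

lemma filter_shrink_eq_some (S : Finset V) (a : {v // v ∈ S}) :
    ({v | shrink S v = some a} : Finset V) = {a.1} := by
  ext v
  by_cases h : v ∈ S
  · simp [shrink_of_mem h, Subtype.ext_iff]
  · simp only [shrink_of_notMem h, mem_filter, mem_univ, true_and, mem_singleton, reduceCtorEq,
      false_iff]
    rintro rfl
    exact h a.2

lemma IsFeasible.cut_singleton {x : V → V → ℝ} (hx : IsFeasible x) (u : V) : cut x {u} = 1 := by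
  have := sum_add_cut x 1 hx.row {u}
  simpa [hx.diag] using this

lemma IsFeasible.isPointedMixture {x : V → V → ℝ} (hx : IsFeasible x) {S : Finset V}
    (hS : Odd #S) (ht : cut x S = 1)
    (h : ∀ y : Option {v // v ∈ S} → Option {v // v ∈ S} → ℝ, IsFeasible y → IsMixture y) :
    IsPointedMixture S x := by
  have hodd : ∀ a, Odd #{u | shrink S u = a} := by
    rintro (_ | a)
    · rw [filter_shrink_eq_none]; exact hx.odd_compl hS
    · rw [filter_shrink_eq_some]; simp
  have htight : ∀ a, cut x {u | shrink S u = a} = 1 := by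
    rintro (_ | a)
    · rw [filter_shrink_eq_none, cut_compl x hx.symm, ht]
    · rw [filter_shrink_eq_some, hx.cut_singleton]
  obtain ⟨ι, hι, c, M, hc, hc1, hM, hsum⟩ := h _ (hx.pushforward (shrink S) hodd htight)
  refine ⟨ι, hι, c, fun i u v => M i (shrink S u) (shrink S v), fun i u => M i (shrink S u) none,
    hc, hc1, fun i => ⟨fun u v => (hM i).symm _ _, fun u => (hM i).diag _, fun u hu => ?_, ?_⟩,
    fun u hu v hv => ?_, fun u hu => ?_⟩
  · rw [← (hM i).row (shrink S u), Fintype.sum_option, add_comm, ← sum_coe_sort S]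
    simp [shrink_of_mem]
  · rw [← (hM i).row none, Fintype.sum_option, (hM i).diag, zero_add, ← sum_coe_sort S]
    exact sum_congr rfl fun v _ => by simp only [shrink_of_mem v.2, (hM i).symm none]
  · simp only [hsum, shrink_of_mem hu, shrink_of_mem hv, filter_shrink_eq_some]
    by_cases huv : u = v
    · subst huv
      simp [hx.diag]
    · simp [huv]
  · simp only [hsum, shrink_of_mem hu, filter_shrink_eq_some, filter_shrink_eq_none]
    simp

/-- The perfect matching composed of a pointed matching `(N, p)` of `S` and a pointed matching
`(N', q)` of the complement, joined by the edge between the two marked vertices. -/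
def glue (S : Finset V) (N N' : V → V → ℕ) (p q : V → ℕ) (u v : V) : ℕ :=
  if u ∈ S then if v ∈ S then N u v else p u * q v
  else if v ∈ S then q u * p v else N' u v

lemma isMatchingMatrix_glue {S : Finset V} {N N' : V → V → ℕ} {p q : V → ℕ}
    (h : IsPointedMatching S N p) (h' : IsPointedMatching Sᶜ N' q) :
    IsMatchingMatrix (glue S N N' p q) where
  symm u v := by
    unfold glue
    split_ifs
    · exact h.symm u v
    · exact mul_comm _ _
    · exact mul_comm _ _
    · exact h'.symm u v
  diag u := by
    unfold glue
    split_ifs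
    · exact h.diag u
    · exact h'.diag u
  row u := by
    rw [← sum_add_sum_compl S]
    by_cases hu : u ∈ S
    · rw [← h.row u hu, ← mul_one (p u), ← h'.sum_point, mul_sum]
      congr 1
      · exact sum_congr rfl fun v hv => by simp [glue, hu, hv]
      · exact sum_congr rfl fun v hv => by simp [glue, hu, mem_compl.1 hv]
    · rw [← h'.row u (mem_compl.2 hu), ← mul_one (q u), ← h.sum_point, mul_sum, add_comm]
      congr 1
      · exact sum_congr rfl fun v hv => by simp [glue, hu, mem_compl.1 hv]
      · exact sum_congr rfl fun v hv => by simp [glue, hu, hv]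

/-- Pointed mixtures on the two sides of a cut of weight one are glued by choosing the crossing
edge `uw` with probability `x u w` and, conditionally on it, the two sides independently. -/
lemma IsPointedMixture.isMixture {x : V → V → ℝ} (hx : IsFeasible x) {S : Finset V}
    (h1 : IsPointedMixture S x) (h2 : IsPointedMixture Sᶜ x) : IsMixture x := by
  obtain ⟨ι, _, c, N, p, hc, hc1, hN, hcN, hcp⟩ := h1
  obtain ⟨κ, _, d, N', q, hd, hd1, hN', hdN, hdq⟩ := h2
  rw [compl_compl] at hdq
  set a : V → ℝ := fun u => ∑ w ∈ Sᶜ, x u w with ha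
  set b : V → ℝ := fun w => ∑ u ∈ S, x w u with hb
  have ha0 : ∀ u, 0 ≤ a u := fun u => sum_nonneg fun _ _ => hx.nonneg _ _
  have hb0 : ∀ u, 0 ≤ b u := fun u => sum_nonneg fun _ _ => hx.nonneg _ _
  -- `0 / 0 = 0` is harmless: a vertex of boundary weight zero is marked with probability zero
  set y : V → V → ℝ := fun u w => x u w / (a u * b w) with hy
  have hyx : ∀ u ∈ S, ∀ w ∈ Sᶜ, y u w * a u * b w = x u w := by
    intro u hu w hw
    have h1 : x u w ≤ a u := single_le_sum (f := fun w => x u w) (fun _ _ => hx.nonneg _ _) hw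
    have h2 : x u w ≤ b w := by
      rw [hx.symm]
      exact single_le_sum (f := fun u => x w u) (fun _ _ => hx.nonneg _ _) hu
    rcases (hx.nonneg u w).eq_or_lt with h0 | h0
    · simp [hy, ← h0]
    · have : a u ≠ 0 := (h0.trans_le h1).ne'
      have : b w ≠ 0 := (h0.trans_le h2).ne'
      simp only [hy]
      field_simp
  -- the joint distribution of the two sides, with marginals `c` and `d`
  set k : ι × κ → ℝ := fun r => c r.1 * d r.2 * ∑ u ∈ S, ∑ w ∈ Sᶜ, p r.1 u * q r.2 w * y u w with hk
  have hk1 : ∀ i, ∑ j, k (i, j) = c i := by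
    intro i
    refine sum_coupling (S := S) (T := Sᶜ) (c := c i) (d := d) (p := p i) (q := q) (a := a)
      (b := b) (x := x) (y := y) (hN i).sum_point ?_ hyx (fun _ _ => rfl) hdq
    intro u hu h0 hau
    have hz := (hcp u hu).trans hau
    rw [sum_eq_zero_iff_of_nonneg fun i _ => mul_nonneg (hc i) (Nat.cast_nonneg _)] at hz
    exact h0 (hz i (mem_univ i))
  have hk2 : ∀ j, ∑ i, k (i, j) = d j := by
    intro j
    have := sum_coupling (S := Sᶜ) (T := S) (c := d j) (d := c) (p := q j) (q := p) (a := b)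
      (b := a) (x := x) (y := fun w u => y u w) (hN' j).sum_point ?_ ?_ (fun _ _ => rfl) hcp
    · rw [← this]
      refine sum_congr rfl fun i _ => ?_
      simp only [hk]
      rw [sum_comm, mul_comm (c i)]
      congr 1
      exact sum_congr rfl fun w _ => sum_congr rfl fun u _ => by ring
    · intro w hw h0 hbw
      have hz := (hdq w hw).trans hbw
      rw [sum_eq_zero_iff_of_nonneg fun i _ => mul_nonneg (hd i) (Nat.cast_nonneg _)] at hz
      exact h0 (hz j (mem_univ j))
    · intro w hw u hu
      rw [hx.symm, ← hyx u hu w hw]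
      ring
  -- the crossing edges receive the right weight since each pointed matching marks one vertex
  have hcross : ∀ u ∈ S, ∀ w ∈ Sᶜ, ∑ r, k r * (p r.1 u * q r.2 w : ℕ) = x u w := by
    intro u hu w hw
    have hkr : ∀ r, k r * (p r.1 u * q r.2 w : ℕ)
        = (c r.1 * p r.1 u) * (d r.2 * q r.2 w) * y u w := by
      intro r
      have hpp : ∀ u' ∈ S, (p r.1 u : ℝ) * p r.1 u' = if u' = u then (p r.1 u : ℝ) else 0 := by
        intro u' hu'
        have := (hN r.1).mul_point hu hu'
        rw [← Nat.cast_mul, this]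
        split_ifs <;> simp
      have hqq : ∀ w' ∈ Sᶜ, (q r.2 w : ℝ) * q r.2 w' = if w' = w then (q r.2 w : ℝ) else 0 := by
        intro w' hw'
        have := (hN' r.2).mul_point hw hw'
        rw [← Nat.cast_mul, this]
        split_ifs <;> simp
      have hs : (p r.1 u * q r.2 w : ℝ) * ∑ u' ∈ S, ∑ w' ∈ Sᶜ, p r.1 u' * q r.2 w' * y u' w'
          = p r.1 u * q r.2 w * y u w := by
        calc _ = ∑ u' ∈ S, ∑ w' ∈ Sᶜ,
              (p r.1 u * p r.1 u' : ℝ) * ((q r.2 w * q r.2 w') * y u' w') := by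
              simp only [mul_sum]
              exact sum_congr rfl fun u' _ => sum_congr rfl fun w' _ => by ring
          _ = ∑ u' ∈ S, ∑ w' ∈ Sᶜ, (if u' = u then (p r.1 u : ℝ) else 0) *
              ((if w' = w then (q r.2 w : ℝ) else 0) * y u' w') :=
              sum_congr rfl fun u' hu' => sum_congr rfl fun w' hw' => by
                rw [hpp u' hu', hqq w' hw']
          _ = _ := by
              simp [ite_mul, hu, mem_compl.1 hw, mul_assoc]
      simp only [hk]
      push_cast
      linear_combination (c r.1 * d r.2) * hs
    rw [sum_congr rfl fun r _ => hkr r, ← sum_mul, Fintype.sum_prod_type]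
    simp only [← mul_sum, ← sum_mul]
    rw [hcp u hu, hdq w hw, ← hyx u hu w hw]
    ring
  refine ⟨ι × κ, inferInstance, k, fun r => glue S (N r.1) (N' r.2) (p r.1) (q r.2),
    fun r => mul_nonneg (mul_nonneg (hc _) (hd _)) (sum_nonneg fun u _ => sum_nonneg fun w _ =>
      mul_nonneg (by positivity) (div_nonneg (hx.nonneg _ _) (mul_nonneg (ha0 _) (hb0 _)))),
    by rw [Fintype.sum_prod_type, sum_congr rfl fun i _ => hk1 i, hc1],
    fun r => isMatchingMatrix_glue (hN r.1) (hN' r.2), fun u v => ?_⟩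
  by_cases hu : u ∈ S <;> by_cases hv : v ∈ S
  · simp only [glue, hu, hv, if_true]
    rw [← hcN u hu v hv, Fintype.sum_prod_type]
    exact sum_congr rfl fun i _ => by rw [← hk1 i, sum_mul]
  · simp only [glue, hu, hv, if_true, if_false]
    exact hcross u hu v (mem_compl.2 hv)
  · simp only [glue, hu, hv, if_true, if_false]
    rw [hx.symm, ← hcross v hv u (mem_compl.2 hu)]
    exact sum_congr rfl fun r _ => by rw [mul_comm (q r.2 u)]
  · simp only [glue, hu, hv, if_false]
    rw [← hdN u (mem_compl.2 hu) v (mem_compl.2 hv), Fintype.sum_prod_type_right]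
    exact sum_congr rfl fun j _ => by rw [← hk2 j, sum_mul]

end Gluing

/-! ### Perfect matchings from Tutte's theorem -/

section Tutte

variable {V : Type u} [Fintype V] [DecidableEq V]

/-- Deleting a vertex set `T` leaves at most `#T` odd components: each of them sends weight at least
one to `T`, and `T` receives weight at most `#T`. -/
lemma IsFeasible.exists_isMatchingMatrix {x : V → V → ℝ} (hx : IsFeasible x) :
    ∃ M : V → V → ℕ, IsMatchingMatrix M ∧ ∀ u v, M u v ≠ 0 → 0 < x u v := by
  classical
  let G : SimpleGraph V :=
    { Adj := fun u v => 0 < x u v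
      symm := ⟨fun u v h => by rwa [hx.symm v u]⟩
      loopless := ⟨fun u h => by simp [hx.diag u] at h⟩ }
  have hG : ∀ T : Set V, ¬ G.IsTutteViolator T := by
    intro T hT
    rw [SimpleGraph.IsTutteViolator] at hT
    set H := ((⊤ : G.Subgraph).deleteVerts T).coe with hH
    let K : H.ConnectedComponent → Finset V := fun C =>
      {v | ∃ h : v ∈ ((⊤ : G.Subgraph).deleteVerts T).verts, H.connectedComponentMk ⟨v, h⟩ = C}
    have hKcard : ∀ C : H.ConnectedComponent, #(K C) = C.supp.ncard := by
      intro C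
      rw [← Set.ncard_image_of_injective _ Subtype.val_injective, ← Set.ncard_coe_finset]
      congr 1
      ext v
      simp [K]
    have hKdisj : ∀ C D : H.ConnectedComponent, C ≠ D → Disjoint (K C) (K D) := by
      intro C D hCD
      rw [disjoint_left]
      intro v hC hD
      simp only [K, mem_filter, mem_univ, true_and] at hC hD
      obtain ⟨h, rfl⟩ := hC
      obtain ⟨_, rfl⟩ := hD
      exact hCD rfl
    have hKcut : ∀ C ∈ H.oddComponents.toFinset, 1 ≤ ∑ u ∈ K C, ∑ v ∈ T.toFinset, x u v := by
      intro C hC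
      rw [Set.mem_toFinset] at hC
      refine (hx.odd_cut (K C) (by rw [hKcard]; exact hC)).trans (sum_le_sum fun u hu => ?_)
      rw [← sum_filter_add_sum_filter_not (K C)ᶜ (· ∈ T)]
      have h0 : ∑ v ∈ (K C)ᶜ with v ∉ T, x u v = 0 := by
        refine sum_eq_zero fun v hv => ?_
        simp only [mem_filter, mem_compl] at hv
        by_contra hne
        have hpos : G.Adj u v := lt_of_le_of_ne (hx.nonneg u v) (Ne.symm hne)
        apply hv.1
        simp only [K, mem_filter, mem_univ, true_and] at hu ⊢
        obtain ⟨hu, rfl⟩ := hu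
        have hv' : v ∈ ((⊤ : G.Subgraph).deleteVerts T).verts := by simp [hv.2]
        refine ⟨hv', SimpleGraph.ConnectedComponent.sound (SimpleGraph.Adj.reachable ?_)⟩
        simp only [hH, SimpleGraph.Subgraph.coe_adj, SimpleGraph.Subgraph.deleteVerts_adj]
        simp at hu
        simp [hv.2, hu, hpos.symm]
      rw [h0, add_zero]
      refine sum_le_sum_of_subset_of_nonneg ?_ fun v _ _ => hx.nonneg u v
      intro v
      simp
    have hle : (#(H.oddComponents.toFinset) : ℝ) ≤ #T.toFinset := by
      calc (#(H.oddComponents.toFinset) : ℝ)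
          = ∑ C ∈ H.oddComponents.toFinset, (1 : ℝ) := by simp
        _ ≤ ∑ C ∈ H.oddComponents.toFinset, ∑ u ∈ K C, ∑ v ∈ T.toFinset, x u v :=
            sum_le_sum hKcut
        _ = ∑ u ∈ H.oddComponents.toFinset.biUnion K, ∑ v ∈ T.toFinset, x u v :=
            (sum_biUnion fun C _ D _ h => hKdisj C D h).symm
        _ ≤ ∑ u, ∑ v ∈ T.toFinset, x u v :=
            sum_le_sum_of_subset_of_nonneg (subset_univ _) fun u _ _ =>
              sum_nonneg fun v _ => hx.nonneg u v
        _ = #T.toFinset := by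
            rw [sum_comm, sum_congr rfl fun v _ => sum_congr rfl fun u _ => hx.symm u v]
            simp [hx.row]
    rw [Set.ncard_eq_toFinset_card', Set.ncard_eq_toFinset_card'] at hT
    exact absurd (Nat.cast_le.1 hle) (not_le.2 hT)
  obtain ⟨M, hM⟩ := SimpleGraph.tutte.2 hG
  rw [SimpleGraph.Subgraph.isPerfectMatching_iff] at hM
  refine ⟨fun u v => if M.Adj u v then 1 else 0, ⟨fun u v => ?_, fun u => ?_, fun u => ?_⟩, ?_⟩
  · simp only [M.adj_comm]
  · exact if_neg fun h => (M.adj_sub h).ne rfl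
  · obtain ⟨w, hw, hu⟩ := hM u
    rw [sum_eq_single w]
    · simp [hw]
    · intro b _ hb
      rw [if_neg fun h => hb (hu b h)]
    · simp
  · intro u v h
    by_cases huv : M.Adj u v
    · exact M.adj_sub huv
    · simp [huv] at h

end Tutte

/-! ### Edmonds' perfect matching polytope theorem -/

section Edmonds

variable {V : Type u} [Fintype V]

lemma IsMixture.of_peel {x y : V → V → ℝ} {M : V → V → ℕ} (hM : IsMatchingMatrix M) {t : ℝ}
    (h0 : 0 ≤ t) (h1 : t ≤ 1) (hxy : ∀ u v, x u v = t * M u v + (1 - t) * y u v)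
    (hy : IsMixture y) : IsMixture x := by
  obtain ⟨ι, _, c, N, hc, hc1, hN, hcN⟩ := hy
  refine ⟨Option ι, inferInstance, fun o => o.elim t fun i => (1 - t) * c i,
    fun o => o.elim M N, ?_, ?_, ?_, fun u v => ?_⟩
  · rintro (_ | i)
    · exact h0
    · exact mul_nonneg (sub_nonneg.2 h1) (hc i)
  · simp [Fintype.sum_option, ← mul_sum, hc1]
  · rintro (_ | i)
    · exact hM
    · exact hN i
  · simp [Fintype.sum_option, mul_assoc, ← mul_sum, hcN, hxy]

variable [DecidableEq V]

/-- Moving away from a perfect matching `M` in the support of `x` until a constraint becomes tight: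
`x = t M + (1 - t) y` where either `y` has smaller support or a new tight odd cut appears, which
is not the boundary of a vertex since `M` crosses it more than once. -/
lemma IsFeasible.exists_peel {x : V → V → ℝ} (hx : IsFeasible x)
    (hcut : ∀ S : Finset V, Odd #S → #S ≠ 1 → #Sᶜ ≠ 1 → cut x S ≠ 1)
    {M : V → V → ℕ} (hM : IsMatchingMatrix M) (hMx : ∀ u v, M u v ≠ 0 → 0 < x u v)
    (hne : ∃ u v, x u v ≠ M u v) :
    ∃ (t : ℝ) (y : V → V → ℝ), 0 ≤ t ∧ t ≤ 1 ∧ IsFeasible y ∧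
      (∀ u v, x u v = t * M u v + (1 - t) * y u v) ∧
      ((∃ S : Finset V, Odd #S ∧ #S ≠ 1 ∧ #Sᶜ ≠ 1 ∧ cut y S = 1) ∨
        #{e : V × V | y e.1 e.2 ≠ 0} < #{e : V × V | x e.1 e.2 ≠ 0}) := by
  classical
  have hMcut1 : ∀ S : Finset V, #S = 1 ∨ #Sᶜ = 1 → cut M S = 1 := by
    have h1 : ∀ u, cut M {u} = 1 := by
      intro u
      have := sum_add_cut M 1 hM.row {u}
      simpa [hM.diag] using this
    rintro S (h | h)
    · obtain ⟨u, rfl⟩ := card_eq_one.1 h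
      exact h1 u
    · obtain ⟨u, hu⟩ := card_eq_one.1 h
      rw [← cut_compl M hM.symm, hu, h1]
  -- constraints are indexed by pairs of vertices and by vertex sets; `f` is the slack of `x` and
  -- `g` the rate at which it is used up
  let f : (V × V) ⊕ Finset V → ℝ := Sum.elim (fun e => x e.1 e.2) fun S => cut x S - 1
  let g : (V × V) ⊕ Finset V → ℝ := Sum.elim (fun e => M e.1 e.2) fun S => cut M S - 1
  let I : Finset ((V × V) ⊕ Finset V) := {i | 0 < g i ∧ ∀ S, i = Sum.inr S → Odd #S}
  have hgpos : ∀ i ∈ I, 0 < g i := fun i hi => (mem_filter.1 hi).2.1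
  have hIne : I.Nonempty := by
    obtain ⟨u, _⟩ := hne
    obtain ⟨v, -, hv⟩ := exists_ne_zero_of_sum_ne_zero (s := univ) (f := M u) (by simp [hM.row])
    refine ⟨Sum.inl (u, v), ?_⟩
    simp only [I, mem_filter, mem_univ, true_and]
    exact ⟨by simpa [g] using Nat.pos_of_ne_zero hv, by simp⟩
  have hnontriv : ∀ S, Sum.inr S ∈ I → Odd #S ∧ #S ≠ 1 ∧ #Sᶜ ≠ 1 := by
    intro S hS
    simp only [I, mem_filter, mem_univ, true_and] at hS
    refine ⟨hS.2 S rfl, ?_, ?_⟩ <;>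
    · intro h
      have := hMcut1 S (by simp [h])
      simp [g, this] at hS
  have hfpos : ∀ i ∈ I, 0 < f i := by
    rintro (e | S) hi
    · have := hgpos _ hi
      simp only [g, Sum.elim_inl, Nat.cast_pos] at this
      exact hMx _ _ this.ne'
    · obtain ⟨h1, h2, h3⟩ := hnontriv S hi
      have h4 := hx.odd_cut S h1
      have h5 := hcut S h1 h2 h3
      exact sub_pos.2 (lt_of_le_of_ne h4 h5.symm)
  obtain ⟨i, hi, hmin⟩ := exists_min_image I (fun i => f i / g i) hIne
  set t := f i / g i with ht
  have ht0 : 0 < t := div_pos (hfpos i hi) (hgpos i hi)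
  have hedge : ∀ u v, t * M u v ≤ x u v := by
    intro u v
    rcases Nat.eq_zero_or_pos (M u v) with h | h
    · simp [h, hx.nonneg]
    · have hmem : Sum.inl (u, v) ∈ I := by simp [I, g, h]
      exact (le_div_iff₀ (hgpos _ hmem)).1 (hmin _ hmem)
  have hset : ∀ S : Finset V, Odd #S → t * (cut M S - 1) ≤ cut x S - 1 := by
    intro S hS
    rcases (hM.one_le_cut hS).eq_or_lt with h | h
    · rw [← h]
      simpa using hx.odd_cut S hS
    · have hmem : Sum.inr S ∈ I := by simp [I, g, h, hS]
      exact (le_div_iff₀ (hgpos _ hmem)).1 (hmin _ hmem)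
  have ht1 : t < 1 := by
    -- otherwise `M ≤ x` entrywise, and equality of the row sums forces `M = x`
    by_contra! h
    obtain ⟨u, v, huv⟩ := hne
    have hle : ∀ v ∈ univ, (M u v : ℝ) ≤ x u v := fun v _ =>
      (le_mul_of_one_le_left (Nat.cast_nonneg _) h).trans (hedge u v)
    have heq : ∑ v, (M u v : ℝ) = ∑ v, x u v := by
      rw [hx.row, ← Nat.cast_sum, hM.row, Nat.cast_one]
    exact huv ((sum_eq_sum_iff_of_le hle).1 heq v (mem_univ v)).symm
  have hs : 0 < 1 - t := sub_pos.2 ht1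
  set y : V → V → ℝ := fun u v => (x u v - t * M u v) / (1 - t) with hy
  have hycut : ∀ S, cut y S = (cut x S - t * cut M S) / (1 - t) := by
    intro S
    simp only [cut, hy, ← sum_div, sum_sub_distrib, ← mul_sum, Nat.cast_sum]
  refine ⟨t, y, ht0.le, ht1.le, ⟨fun u v => ?_, fun u v => ?_, fun u => ?_, fun u => ?_,
    fun S hS => ?_⟩, fun u v => ?_, ?_⟩
  · simp only [hy, hx.symm u v, hM.symm u v]
  · exact div_nonneg (sub_nonneg.2 (hedge u v)) hs.le
  · simp [hy, hx.diag, hM.diag]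
  · simp only [hy, ← sum_div, sum_sub_distrib, ← mul_sum, ← Nat.cast_sum, hx.row, hM.row]
    rw [Nat.cast_one, mul_one, div_self hs.ne']
  · rw [hycut, le_div_iff₀ hs]
    linarith [hset S hS]
  · simp only [hy]
    field_simp
    ring
  · rcases i with e | S
    · right
      apply card_lt_card
      rw [ssubset_iff_of_subset]
      · refine ⟨e, ?_, ?_⟩
        · simpa [f] using (hfpos _ hi).ne'
        · have : t * M e.1 e.2 = x e.1 e.2 := div_mul_cancel₀ _ (hgpos _ hi).ne'
          simp [hy, this]
      · intro e' he'
        simp only [mem_filter, mem_univ, true_and] at he' ⊢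
        intro h0
        apply he'
        have : M e'.1 e'.2 = 0 := by
          by_contra hM0
          exact (hMx _ _ hM0).ne' h0
        simp [hy, h0, this]
    · left
      obtain ⟨h1, h2, h3⟩ := hnontriv S hi
      refine ⟨S, h1, h2, h3, ?_⟩
      have : t * (cut M S - 1) = cut x S - 1 := div_mul_cancel₀ _ (hgpos _ hi).ne'
      rw [hycut, div_eq_one_iff_eq hs.ne']
      linarith

/-- Shrinking either side of a tight odd cut which is not the boundary of a vertex. -/
lemma IsFeasible.isMixture_of_cut {x : V → V → ℝ} (hx : IsFeasible x)
    (ih : ∀ (W : Type u) [Fintype W] [DecidableEq W], Fintype.card W < Fintype.card V →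
      ∀ y : W → W → ℝ, IsFeasible y → IsMixture y)
    {S : Finset V} (hS : Odd #S) (h1 : #S ≠ 1) (h2 : #Sᶜ ≠ 1) (ht : cut x S = 1) :
    IsMixture x := by
  have hS' := hx.odd_compl hS
  have hcard := card_add_card_compl S
  have hp := hS.pos
  have hp' := hS'.pos
  refine IsPointedMixture.isMixture hx
    (hx.isPointedMixture hS ht (ih _ ?_)) (hx.isPointedMixture hS' ?_ (ih _ ?_))
  · rw [Fintype.card_option, Fintype.card_coe]
    omega
  · rw [cut_compl x hx.symm, ht]
  · rw [Fintype.card_option, Fintype.card_coe]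
    omega

/-- **Edmonds' perfect matching polytope theorem**, for weightings of the complete graph on `V`. The
general case follows because a mixture only involves matchings in the support of the weighting. -/
theorem IsFeasible.isMixture {V : Type u} [Fintype V] [DecidableEq V] {x : V → V → ℝ}
    (hx : IsFeasible x) : IsMixture x := by
  induction hn : Fintype.card V using Nat.strong_induction_on generalizing V with
  | _ n ihn =>
  subst hn
  have ih : ∀ (W : Type u) [Fintype W] [DecidableEq W], Fintype.card W < Fintype.card V →
      ∀ y : W → W → ℝ, IsFeasible y → IsMixture y := fun W _ _ hW y hy => ihn _ hW hy rfl
  induction hk : #{e : V × V | x e.1 e.2 ≠ 0} using Nat.strong_induction_on generalizing x with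
  | _ k ihk =>
  subst hk
  by_cases hcut : ∃ S : Finset V, Odd #S ∧ #S ≠ 1 ∧ #Sᶜ ≠ 1 ∧ cut x S = 1
  · obtain ⟨S, hS, h1, h2, ht⟩ := hcut
    exact hx.isMixture_of_cut ih hS h1 h2 ht
  push Not at hcut
  obtain ⟨M, hM, hMx⟩ := hx.exists_isMatchingMatrix
  by_cases hne : ∃ u v, x u v ≠ M u v
  · obtain ⟨t, y, h0, h1, hy, hxy, ⟨S, hS, hS1, hS2, ht⟩ | hlt⟩ := hx.exists_peel hcut hM hMx hne
    · exact .of_peel hM h0 h1 hxy (hy.isMixture_of_cut ih hS hS1 hS2 ht)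
    · exact .of_peel hM h0 h1 hxy (ihk _ hlt hy rfl)
  · push Not at hne
    exact ⟨PUnit, inferInstance, fun _ => 1, fun _ => M, by simp, by simp, fun _ => hM,
      by simp [hne]⟩

end Edmonds

/-! ### Two-factors of bridgeless cubic graphs -/

section TwoFactors

/-- Among the even numbers `k ≤ b`, the contribution of `k = 0` and `k = a` to the weighted count
equals `2 b - 3 k`. Every other `k` contributes zero and satisfies `k ≤ a - 2 ≤ 2 b / 3`; there is
no such `k` for `b = 2`, whence no sign condition on `A` in that case. -/
lemma contribution_le {b k : ℕ} (hb : b ∈ ({2, 4, 5, 6, 7, 9} : Set ℕ)) (hk : Even k)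
    (hkb : k ≤ b) {A : ℝ} (hA : b ≠ 2 → 0 ≤ A) :
    A * (2 * (b : ℝ) * (if k = 0 then 1 else 0)
      - (3 * ((2 * (b / 2) : ℕ) : ℝ) - 2 * b) * (if k = 2 * (b / 2) then 1 else 0))
      ≤ A * (2 * b - 3 * k) := by
  simp only [Set.mem_insert_iff, Set.mem_singleton_iff] at hb
  obtain ⟨m, rfl⟩ := hk
  have hm : m ≤ b / 2 := by omega
  rcases eq_or_ne b 2 with rfl | h2
  · apply le_of_eq
    congr 1
    interval_cases m <;> norm_num
  · apply mul_le_mul_of_nonneg_left _ (hA h2)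
    rcases hb with rfl | rfl | rfl | rfl | rfl | rfl <;> interval_cases m <;> norm_num

variable {V : Type u}

open Classical in
/-- The adjacency matrix of a relation. -/
noncomputable def adjacency (r : V → V → Prop) (u v : V) : ℕ := if r u v then 1 else 0

lemma adjacency_symm {r : V → V → Prop} (h : ∀ u v, r u v ↔ r v u) (u v : V) :
    adjacency r u v = adjacency r v u := by
  unfold adjacency
  split_ifs <;> grind

variable [Fintype V]

lemma ncard_level {G : SimpleGraph V} (C : GoodCollection G) (F : G.Subgraph) (k : ℕ) :
    ((C.level F k).ncard : ℝ) = ∑ H ∈ C.members.toFinite.toFinset,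
      if (boundary G H.verts ∩ F.edgeSet).ncard = k then 1 else 0 := by
  rw [sum_boole, ← Set.ncard_coe_finset]
  congr 2
  ext H
  simp [GoodCollection.level]

lemma sum_adjacency {G : SimpleGraph V} [DecidableRel G.Adj] (hcubic : G.IsRegularOfDegree 3)
    (u : V) : ∑ v, adjacency G.Adj u v = 3 := by
  rw [← hcubic u, ← G.card_neighborFinset_eq_degree, G.neighborFinset_eq_filter, card_filter]
  exact sum_congr rfl fun v _ => by simp [adjacency]

/-- The spanning subgraph of `G` obtained by deleting the edges of the matching `M`. -/
def removeMatching (G : SimpleGraph V) {M : V → V → ℕ} (hM : IsMatchingMatrix M) : G.Subgraph where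
  verts := Set.univ
  Adj u v := G.Adj u v ∧ M u v = 0
  adj_sub h := h.1
  edge_vert _ := trivial
  symm := ⟨fun u v h => ⟨h.1.symm, by rw [hM.symm, h.2]⟩⟩

variable {G : SimpleGraph V} {M : V → V → ℕ}

lemma adjacency_removeMatching_add (hM : IsMatchingMatrix M) (hMG : ∀ u v, M u v ≠ 0 → G.Adj u v)
    (u v : V) : adjacency (removeMatching G hM).Adj u v + M u v = adjacency G.Adj u v := by
  have h1 : M u v ≤ 1 :=
    (hM.row u).symm ▸ single_le_sum (f := M u) (fun _ _ => Nat.zero_le _) (mem_univ v)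
  have h2 := hMG u v
  simp only [adjacency, removeMatching]
  split_ifs <;> grind

lemma sum_adjacency_removeMatching [DecidableRel G.Adj] (hcubic : G.IsRegularOfDegree 3)
    (hM : IsMatchingMatrix M) (hMG : ∀ u v, M u v ≠ 0 → G.Adj u v) (u : V) :
    ∑ v, adjacency (removeMatching G hM).Adj u v = 2 := by
  have h := sum_adjacency hcubic u
  simp only [← adjacency_removeMatching_add hM hMG, sum_add_distrib, hM.row] at h
  omega

lemma isTwoFactor_removeMatching [DecidableRel G.Adj] (hcubic : G.IsRegularOfDegree 3)
    (hM : IsMatchingMatrix M) (hMG : ∀ u v, M u v ≠ 0 → G.Adj u v) :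
    IsTwoFactor (removeMatching G hM) := by
  classical
  refine ⟨fun _ => trivial, fun u => ?_⟩
  rw [← sum_adjacency_removeMatching hcubic hM hMG u, Set.ncard_eq_toFinset_card']
  simp only [adjacency, sum_boole, Nat.cast_id]
  congr 1
  ext v
  simp

variable [DecidableEq V]

lemma ncard_boundary_inter (F : G.Subgraph) (S : Finset V) :
    (boundary G S ∩ F.edgeSet).ncard = cut (adjacency F.Adj) S := by
  classical
  have hcut : cut (adjacency F.Adj) S = #{e ∈ S ×ˢ Sᶜ | F.Adj e.1 e.2} := by
    rw [card_filter, sum_product]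
    simp only [cut, adjacency]
  have himg : boundary G S ∩ F.edgeSet
      = (fun e : V × V => s(e.1, e.2)) '' ({e ∈ S ×ˢ Sᶜ | F.Adj e.1 e.2} : Finset (V × V)) := by
    ext e
    constructor
    · rintro ⟨⟨-, u, hu, v, hv, rfl⟩, he⟩
      exact ⟨(u, v), by simpa using ⟨⟨hu, hv⟩, he⟩, rfl⟩
    · rintro ⟨⟨u, v⟩, he, rfl⟩
      simp only [coe_filter, mem_product, mem_compl, Set.mem_ofPred_eq] at he
      exact ⟨⟨F.adj_sub he.2, u, he.1.1, v, he.1.2, rfl⟩, he.2⟩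
  rw [hcut, himg, Set.InjOn.ncard_image, Set.ncard_coe_finset]
  rintro ⟨u, v⟩ h ⟨u', v'⟩ h' heq
  simp only [coe_filter, mem_product, mem_compl, Set.mem_ofPred_eq] at h h'
  rcases Sym2.eq_iff.1 heq with ⟨rfl, rfl⟩ | ⟨rfl, rfl⟩
  · rfl
  · exact absurd h.1.1 h'.1.2

lemma ncard_boundary (G : SimpleGraph V) (S : Finset V) :
    (boundary G S).ncard = cut (adjacency G.Adj) S := by
  have h : boundary G S ∩ (⊤ : G.Subgraph).edgeSet = boundary G S := by
    rw [SimpleGraph.Subgraph.edgeSet_top]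
    exact Set.inter_eq_left.2 fun e he => he.1
  rw [← h, ncard_boundary_inter]
  rfl

lemma isBridge_of_cut_eq_one {S : Finset V}
    (h : cut (adjacency G.Adj) S = 1) : ∃ e ∈ G.edgeSet, G.IsBridge e := by
  rw [← ncard_boundary, Set.ncard_eq_one] at h
  obtain ⟨e, he⟩ := h
  obtain ⟨heG, u, hu, v, hv, rfl⟩ : e ∈ boundary G S := by rw [he]; rfl
  refine ⟨_, heG, ?_⟩
  rw [SimpleGraph.isBridge_iff]
  rintro ⟨p⟩
  obtain ⟨d, -, h1, h2⟩ := p.exists_boundary_dart S hu hv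
  have hd := d.adj
  rw [SimpleGraph.deleteEdges_adj] at hd
  have hmem : s(d.fst, d.snd) ∈ boundary G S := ⟨hd.1, _, h1, _, h2, rfl⟩
  rw [he] at hmem
  exact hd.2 hmem

lemma even_cut_adjacency_iff [DecidableRel G.Adj]
    (hcubic : G.IsRegularOfDegree 3) (S : Finset V) :
    Even (cut (adjacency G.Adj) S) ↔ Even #S := by
  rw [even_cut_iff _ (adjacency_symm G.adj_comm) (by simp [adjacency]) 3
    (sum_adjacency hcubic), Nat.even_mul]
  simp [show ¬ Even 3 by decide]

/-- In a bridgeless cubic graph, the constant weight `1 / 3` lies in the perfect matching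
polytope: an odd vertex set has an odd number of boundary edges, and this number is not one. -/
lemma isFeasible_third [DecidableRel G.Adj] (hcubic : G.IsRegularOfDegree 3)
    (hb : Bridgeless G) : IsFeasible fun u v => (adjacency G.Adj u v : ℝ) / 3 where
  symm u v := by simp [adjacency, G.adj_comm]
  nonneg u v := by positivity
  diag u := by simp [adjacency]
  row u := by
    rw [← sum_div, ← Nat.cast_sum, sum_adjacency hcubic]
    norm_num
  odd_cut S hS := by
    have h : cut (fun u v => (adjacency G.Adj u v : ℝ) / 3) S
        = (cut (adjacency G.Adj) S : ℕ) / 3 := by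
      simp [cut, sum_div]
    have hodd : Odd (cut (adjacency G.Adj) S) := by
      rwa [← Nat.not_even_iff_odd, even_cut_adjacency_iff hcubic, Nat.not_even_iff_odd]
    have h1 : cut (adjacency G.Adj) S ≠ 1 := fun h => by
      obtain ⟨e, he, hbr⟩ := isBridge_of_cut_eq_one h
      exact hb e he hbr
    have h3 : 3 ≤ cut (adjacency G.Adj) S := by
      obtain ⟨k, hk⟩ := hodd
      omega
    rw [h, le_div_iff₀ (by norm_num), one_mul]
    exact_mod_cast h3

lemma cut_removeMatching_add (hM : IsMatchingMatrix M) (hMG : ∀ u v, M u v ≠ 0 → G.Adj u v)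
    (S : Finset V) :
    cut (adjacency (removeMatching G hM).Adj) S + cut M S = cut (adjacency G.Adj) S := by
  simp only [cut, ← sum_add_distrib, adjacency_removeMatching_add hM hMG]

lemma even_cut_removeMatching [DecidableRel G.Adj] (hcubic : G.IsRegularOfDegree 3)
    (hM : IsMatchingMatrix M) (hMG : ∀ u v, M u v ≠ 0 → G.Adj u v) (S : Finset V) :
    Even (cut (adjacency (removeMatching G hM).Adj) S) := by
  rw [even_cut_iff _ (adjacency_symm fun u v => SimpleGraph.Subgraph.adj_comm ..)
    (by simp [adjacency, removeMatching]) 2 (sum_adjacency_removeMatching hcubic hM hMG)]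
  exact even_two.mul_left _

/-- For a collection `C`, the weighted count is bounded by a quantity which is linear in the
perfect matching `M` complementary to the `2`-factor. -/
lemma collection_le [DecidableRel G.Adj] (hcubic : G.IsRegularOfDegree 3)
    (hM : IsMatchingMatrix M) (hMG : ∀ u v, M u v ≠ 0 → G.Adj u v) (C : GoodCollection G) {A : ℝ}
    (hA : C.b ≠ 2 → 0 ≤ A) :
    A * (2 * (C.b : ℝ) * ((C.level (removeMatching G hM) 0).ncard : ℝ)
        - (3 * (C.a : ℝ) - 2 * (C.b : ℝ)) * ((C.star (removeMatching G hM)).ncard : ℝ))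
      ≤ ∑ H ∈ C.members.toFinite.toFinset,
        A * (3 * (cut M H.verts.toFinite.toFinset : ℕ) - C.b) := by
  rw [GoodCollection.star, ncard_level, ncard_level, mul_sum, mul_sum, ← sum_sub_distrib, mul_sum]
  refine sum_le_sum fun H hH => ?_
  have hX := ncard_boundary_inter (removeMatching G hM) H.verts.toFinite.toFinset
  have hb := ncard_boundary G H.verts.toFinite.toFinset
  rw [Set.Finite.coe_toFinset] at hX hb
  rw [C.card_boundary H (by simpa using hH)] at hb
  have hadd := cut_removeMatching_add hM hMG H.verts.toFinite.toFinset
  rw [← hb, ← hX] at hadd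
  have heven := even_cut_removeMatching hcubic hM hMG H.verts.toFinite.toFinset
  rw [← hX] at heven
  refine (contribution_le C.b_mem heven (by omega) hA).trans_eq ?_
  congr 1
  rw [← hadd]
  push_cast
  ring

end TwoFactors

end CubicFactor

open CubicFactor

theorem mainTheorem4 {V : Type*} [Fintype V] (G : SimpleGraph V) [DecidableRel G.Adj]
    (hcubic : G.IsRegularOfDegree 3) (hbridgeless : CubicFactor.Bridgeless G)
    (I : Finset (CubicFactor.GoodCollection G)) (A : CubicFactor.GoodCollection G → ℝ)
    (hA : ∀ C ∈ I, C.b ≠ 2 → 0 ≤ A C) :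
    ∃ F : G.Subgraph, CubicFactor.IsTwoFactor F ∧
      (∀ S : Set (Sym2 V), CubicFactor.IsEdgeCut G 3 S → (S ∩ F.edgeSet).ncard = 2) ∧
      ∑ C ∈ I, A C * (2 * (C.b : ℝ) * ((C.level F 0).ncard : ℝ)
        - (3 * (C.a : ℝ) - 2 * (C.b : ℝ)) * ((C.star F).ncard : ℝ)) ≤ 0 := by
  classical
  obtain ⟨ι, _, c, M, hc, hc1, hM, hsum⟩ := (isFeasible_third hcubic hbridgeless).isMixture
  have hsupp : ∀ i, 0 < c i → ∀ u v, M i u v ≠ 0 → G.Adj u v := by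
    intro i hi u v h
    by_contra hadj
    have h0 := hsum u v
    simp only [adjacency, if_neg hadj, Nat.cast_zero, zero_div] at h0
    rw [sum_eq_zero_iff_of_nonneg fun j _ => mul_nonneg (hc j) (Nat.cast_nonneg _)] at h0
    exact mul_ne_zero hi.ne' (Nat.cast_ne_zero.2 h) (h0 i (mem_univ i))
  have hmean : ∀ S : Finset V,
      ∑ i, c i * (cut (M i) S : ℕ) = (cut (adjacency G.Adj) S : ℕ) / 3 := by
    intro S
    simp only [cut, Nat.cast_sum, mul_sum, sum_div]
    rw [sum_comm]
    refine sum_congr rfl fun u _ => ?_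
    rw [sum_comm]
    exact sum_congr rfl fun v _ => hsum u v
  -- the linear bound vanishes on average
  let Ψ : ι → ℝ := fun i => ∑ C ∈ I, ∑ H ∈ C.members.toFinite.toFinset,
    A C * (3 * (cut (M i) H.verts.toFinite.toFinset : ℕ) - C.b)
  have hΨ : ∑ i, c i * Ψ i = 0 := by
    simp only [Ψ, mul_sum]
    rw [sum_comm]
    refine sum_eq_zero fun C _ => ?_
    rw [sum_comm]
    refine sum_eq_zero fun H hH => ?_
    have h1 := hmean H.verts.toFinite.toFinset
    have h2 := ncard_boundary G H.verts.toFinite.toFinset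
    rw [Set.Finite.coe_toFinset, C.card_boundary H (by simpa using hH)] at h2
    rw [← h2] at h1
    calc _ = A C * (3 * ∑ i, c i * (cut (M i) H.verts.toFinite.toFinset : ℕ)
          - C.b * ∑ i, c i) := by
          simp only [mul_sum, ← sum_sub_distrib]
          exact sum_congr rfl fun i _ => by ring
      _ = 0 := by rw [h1, hc1]; ring
  obtain ⟨i, hi, hΨi⟩ : ∃ i, 0 < c i ∧ Ψ i ≤ 0 := by
    by_contra! hcon
    have hnn : ∀ i ∈ univ, 0 ≤ c i * Ψ i := fun i _ => by
      rcases (hc i).eq_or_lt with h | h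
      · simp [← h]
      · exact mul_nonneg h.le (hcon i h).le
    have hz := (sum_eq_zero_iff_of_nonneg hnn).1 hΨ
    have : ∑ i, c i = 0 := sum_eq_zero fun i _ => by
      by_contra h
      have hpos := (hc i).lt_of_ne' h
      exact (mul_pos hpos (hcon i hpos)).ne' (hz i (mem_univ i))
    rw [hc1] at this
    exact one_ne_zero this
  have hMG := hsupp i hi
  refine ⟨removeMatching G (hM i), isTwoFactor_removeMatching hcubic (hM i) hMG, ?_,
    (sum_le_sum fun C hC => collection_le hcubic (hM i) hMG C (hA C hC)).trans hΨi⟩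
  rintro _ ⟨h3, W, rfl⟩
  obtain ⟨S, rfl⟩ : ∃ S : Finset V, (S : Set V) = W := W.toFinite.exists_finset_coe
  rw [ncard_boundary] at h3
  have hodd : Odd #S := by
    rw [← Nat.not_even_iff_odd, ← even_cut_adjacency_iff hcubic, h3]
    decide
  -- every matching crosses the cut at least once, and once on average
  have hone : cut (M i) S = 1 := by
    have hz : ∑ j, c j * ((cut (M j) S : ℕ) - 1 : ℝ) = 0 := by
      simp only [mul_sub, sum_sub_distrib, hmean, h3, mul_one, hc1]
      norm_num
    rw [sum_eq_zero_iff_of_nonneg fun j _ => mul_nonneg (hc j)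
      (sub_nonneg.2 (by exact_mod_cast (hM j).one_le_cut hodd))] at hz
    have := (mul_eq_zero.1 (hz i (mem_univ i))).resolve_left hi.ne'
    exact_mod_cast sub_eq_zero.1 this
  rw [ncard_boundary_inter]
  have := cut_removeMatching_add (hM i) hMG S
  omega
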